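/- Let $\delta\in(0,1)$ and $k=\lceil 360\log(2/\delta)\rceil$, and let $N\ge 1$ be divisible by $k$. Let $X_1,\dots,X_N$ be i.i.d. random vectors in $\mathbb{R}^d$ with finite second moment, mean $\mu$ and covariance matrix $\Sigma$, whose largest eigenvalue is denoted by $\lambda_{\max}$. Partition $\{1,\dots,N\}$ into $k$ blocks $B_1,\dots,B_k$, each of size $m=N/k$, and let $Z_j=\frac1m\sum_{i\in B_j}X_i$ be the block means. For $a\in\mathbb{R}^d$ let $$S_a=\Big\{x\in\mathbb{R}^d:\ \exists J\subset\{1,\dots,k\},\ |J|>k/2,\ \|Z_j-x\|>\|Z_j-a\|\ \text{for all } j\in J\Big\},$$ where $\|\cdot\|$ is the Euclidean norm, and let $\widehat\mu_N\in\operatorname{argmin}_{a\in\mathbb{R}^d}\operatorname{diam}(S_a^c)$, where $S_a^c=\mathbb{R}^d\setminus S_a$. The minimum is attained for every value of the sample, and with probability at least $1-\delta$, every choice of the minimizer $\widehat\mu_N$ satisfies $$\|\widehat\mu_N-\mu\|\le 2\max\left(400\sqrt{\frac{\operatorname{Tr}(\Sigma)}{N}},\ 240\sqrt{\frac{\lambda_{\max}\log(2/\delta)}{N}}\right).$$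 -/

import Mathlib

open MeasureTheory ProbabilityTheory

noncomputable section

/-- The mean vector of a distribution `ν` on `ℝ^d`. -/
def meanVec {d : ℕ} (ν : Measure (EuclideanSpace ℝ (Fin d))) : EuclideanSpace ℝ (Fin d) :=
  ∫ x, x ∂ν

/-- The covariance matrix of a distribution `ν` on `ℝ^d`. -/
def covarianceMatrix {d : ℕ} (ν : Measure (EuclideanSpace ℝ (Fin d))) : Matrix (Fin d) (Fin d) ℝ :=
  Matrix.of fun p q => ∫ x, (x p - meanVec ν p) * (x q - meanVec ν q) ∂ν

/-- The largest eigenvalue of a real symmetric matrix (`0` for the empty matrix). -/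
def lambdaMax {d : ℕ} (A : Matrix (Fin d) (Fin d) ℝ) : ℝ :=
  sSup {t : ℝ | Module.End.HasEigenvalue (Matrix.toLin' A) t}

/-- `B` is a partition of the `N` indices into `k` blocks of equal size `N / k`. -/
structure IsEqualPartition {k N : ℕ} (B : Fin k → Finset (Fin N)) : Prop where
  disjoint : ∀ j j', j ≠ j' → Disjoint (B j) (B j')
  cover : ∀ i, ∃ j, i ∈ B j
  card_eq : ∀ j, (B j).card = N / k

/-- The sample mean of the points `x i` within the block `B j`. -/
def blockMean {d k N : ℕ} (B : Fin k → Finset (Fin N))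
    (x : Fin N → EuclideanSpace ℝ (Fin d)) (j : Fin k) : EuclideanSpace ℝ (Fin d) :=
  ((B j).card : ℝ)⁻¹ • ∑ i ∈ B j, x i

/-- The set `S_a` of the points `x` that are strictly farther than `a` from more than `k / 2` of
the points `Z j`. -/
def defeatedSet {d k : ℕ} (Z : Fin k → EuclideanSpace ℝ (Fin d))
    (a : EuclideanSpace ℝ (Fin d)) : Set (EuclideanSpace ℝ (Fin d)) :=
  {x | ∃ J : Finset (Fin k), (k : ℝ) / 2 < (J.card : ℝ) ∧ ∀ j ∈ J, 0 < ‖Z j - x‖ - ‖Z j - a‖}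

/-- `a` minimizes the diameter of the complement of `S_a` over all points of `ℝ^d`.
(For `k ≥ 1` all these complements are bounded.) -/
def IsTournamentMedian {d k : ℕ} (Z : Fin k → EuclideanSpace ℝ (Fin d))
    (a : EuclideanSpace ℝ (Fin d)) : Prop :=
  ∀ b, Metric.diam (defeatedSet Z a)ᶜ ≤ Metric.diam (defeatedSet Z b)ᶜ

end

/-!
The estimator is compared with `μ = meanVec ν` through one statement: with probability at least
`1 - δ`, for every unit vector `u`, fewer than half of the block means `Z j` satisfy
`r / 2 < ⟪Z j - μ, u⟫`, where `r` is the maximum in the theorem. Expanding squares, `μ` then defeats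
every point at distance more than `r` (`mem_defeatedSet_of_card_lt`). So the complement of
`defeatedSet Z μ` lies in a ball of radius `r`, and since of any two points at least one fails to
be defeated by the other, a minimizer of the diameter is within `2 * r` of `μ`
(`IsTournamentMedian.norm_sub_le`).

The uniform statement is proved by a PAC-Bayesian argument, without symmetrization or chaining. Let
`γ` be the standard Gaussian measure and `Y j = Z j - μ`. For a fixed direction `v`, the number of
`j` with `c < ⟪Y j, v⟫` is a sum of independent indicators with mean at most
`q v = Var ⟪Y j, v⟫ / c ^ 2`, so that this number minus `(e - 1) * k * q v` has exponential moment
at most `1`. Averaging the exponential over `v ∼ γ` and applying Markov's inequality gives one event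
of probability at least `1 - δ`. On this event, moving `γ` to its translate by `h` costs only
`‖h‖ ^ 2 / 2` (`exp_integral_shift_sub_le`, a consequence of the Cameron–Martin formula), for all
`h` at once. Passing from the Gaussian average around `h` back to `h` itself loses a factor `2`
(`exists_event_card_le`). With `h = s • u` and `c = s * r / 2`, the average of `q` over the translate
is bounded by a multiple of `(Tr Σ + s ^ 2 * λ_max) / (m * s ^ 2 * r ^ 2)`, where `m = N / k`: the
trace comes from `∫ ⟪v, Σ v⟫ ∂γ = Tr Σ` and the eigenvalue from the Rayleigh quotient at `u`. For
`s ^ 2 = k / 10` all terms add up to less than `k / 2`.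

A minimizer exists because `a ↦ diam (defeatedSet Z a)ᶜ` is coercive and, by strict convexity of
Euclidean balls, lower semicontinuous (`exists_isTournamentMedian`).
-/

/-! ### Tournament sets and their diameters -/

section Tournament

variable {d k : ℕ} {Z : Fin k → EuclideanSpace ℝ (Fin d)}

lemma mem_compl_defeatedSet {a x : EuclideanSpace ℝ (Fin d)} :
    x ∈ (defeatedSet Z a)ᶜ ↔
      ∃ I : Finset (Fin k), k ≤ 2 * I.card ∧ ∀ j ∈ I, ‖Z j - x‖ ≤ ‖Z j - a‖ := by
  classical
  constructor
  · intro hx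
    refine ⟨Finset.univ.filter fun j => ‖Z j - x‖ ≤ ‖Z j - a‖, ?_, by simp⟩
    by_contra! hlt
    refine hx ⟨Finset.univ.filter fun j => ¬ ‖Z j - x‖ ≤ ‖Z j - a‖, ?_, by simp⟩
    have hsum := Finset.card_filter_add_card_filter_not (s := (Finset.univ : Finset (Fin k)))
      (fun j => ‖Z j - x‖ ≤ ‖Z j - a‖)
    simp only [Finset.card_univ, Fintype.card_fin] at hsum
    rw [div_lt_iff₀ two_pos]
    exact_mod_cast (by omega : k <
      (Finset.univ.filter fun j => ¬ ‖Z j - x‖ ≤ ‖Z j - a‖).card * 2)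
  · rintro ⟨I, hI, hIle⟩ ⟨J, hJ, hJlt⟩
    rw [div_lt_iff₀ two_pos] at hJ
    have hJ' : k < J.card * 2 := by exact_mod_cast hJ
    have hdisj : Disjoint I J := Finset.disjoint_left.2 fun j hjI hjJ => by
      linarith [hIle j hjI, hJlt j hjJ]
    have := Finset.card_le_univ (I ∪ J)
    rw [Finset.card_union_of_disjoint hdisj, Fintype.card_fin] at this
    omega

lemma self_mem_compl_defeatedSet (a : EuclideanSpace ℝ (Fin d)) : a ∈ (defeatedSet Z a)ᶜ :=
  mem_compl_defeatedSet.2 ⟨Finset.univ, by simp; omega, fun _ _ => le_rfl⟩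

lemma isBounded_compl_defeatedSet (hk : 0 < k) (a : EuclideanSpace ℝ (Fin d)) :
    Bornology.IsBounded (defeatedSet Z a)ᶜ := by
  have hb : Bornology.IsBounded (⋃ j, Metric.closedBall (Z j) ‖Z j - a‖) :=
    Bornology.isBounded_iUnion.2 fun j => Metric.isBounded_closedBall
  refine hb.subset fun x hx => ?_
  obtain ⟨I, hI, hle⟩ := mem_compl_defeatedSet.1 hx
  obtain ⟨j, hj⟩ : I.Nonempty := Finset.card_pos.1 (by omega)
  exact Set.mem_iUnion.2 ⟨j, by simpa [dist_eq_norm, norm_sub_rev x] using hle j hj⟩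

/-- Two strict majorities intersect, so a point cannot defeat a point that defeats it. -/
lemma mem_compl_defeatedSet_of_mem {a b : EuclideanSpace ℝ (Fin d)}
    (h : a ∈ defeatedSet Z b) : b ∈ (defeatedSet Z a)ᶜ := by
  obtain ⟨J, hJ, hlt⟩ := h
  rw [div_lt_iff₀ two_pos] at hJ
  have hJ' : k < J.card * 2 := by exact_mod_cast hJ
  exact mem_compl_defeatedSet.2 ⟨J, by omega, fun j hj => by linarith [hlt j hj]⟩

/-- Lower hemicontinuity of `a ↦ (defeatedSet Z a)ᶜ`. A point `x ≠ a` of the set is moved slightly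
towards `a`; by strict convexity the new point lies strictly inside the balls that contain `x`, and
therefore stays in the set when `a` is perturbed. -/
lemma eventually_exists_near_mem_compl_defeatedSet {a x : EuclideanSpace ℝ (Fin d)}
    (hx : x ∈ (defeatedSet Z a)ᶜ) {ε : ℝ} (hε : 0 < ε) :
    ∀ᶠ b in nhds a, ∃ y ∈ (defeatedSet Z b)ᶜ, dist y x < ε := by
  rcases eq_or_ne x a with rfl | hxa
  · filter_upwards [Metric.ball_mem_nhds x hε] with b hb
    exact ⟨b, self_mem_compl_defeatedSet b, hb⟩
  obtain ⟨I, hI, hle⟩ := mem_compl_defeatedSet.1 hx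
  have hpos : 0 < ‖a - x‖ := norm_pos_iff.2 (sub_ne_zero.2 hxa.symm)
  set t : ℝ := min (1 / 2) (ε / (2 * ‖a - x‖)) with ht
  have ht0 : 0 < t := lt_min (by norm_num) (by positivity)
  have ht1 : t < 1 := (min_le_left _ _).trans_lt (by norm_num)
  have htε : t * ‖a - x‖ < ε := by
    have : t * ‖a - x‖ ≤ ε / (2 * ‖a - x‖) * ‖a - x‖ :=
      mul_le_mul_of_nonneg_right (min_le_right _ _) hpos.le
    have h2 : ε / (2 * ‖a - x‖) * ‖a - x‖ = ε / 2 := by field_simp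
    linarith
  set y := (1 - t) • x + t • a with hy
  have hyx : dist y x < ε := by
    have : y - x = t • (a - x) := by rw [hy]; module
    rw [dist_eq_norm, this, norm_smul, Real.norm_of_nonneg ht0.le]
    exact htε
  have hstrict : ∀ j ∈ I, ‖Z j - y‖ < ‖Z j - a‖ := fun j hj => by
    have := combo_mem_ball_of_ne (z := Z j) (r := ‖Z j - a‖) (x := x) (y := a)
      (by simpa [dist_eq_norm, norm_sub_rev x] using hle j hj)
      (by simp [dist_eq_norm, norm_sub_rev a]) hxa (sub_pos.2 ht1) ht0 (by ring)
    simpa [dist_eq_norm, norm_sub_rev _ (Z j), ← hy] using this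
  have hev : ∀ᶠ b in nhds a, ∀ j ∈ I, ‖Z j - y‖ < ‖Z j - b‖ :=
    (Filter.eventually_all_finset I).2 fun j hj =>
      (by fun_prop : Continuous fun b => ‖Z j - b‖).continuousAt.eventually
        (lt_mem_nhds (hstrict j hj))
  filter_upwards [hev] with b hb
  exact ⟨y, mem_compl_defeatedSet.2 ⟨I, hI, fun j hj => (hb j hj).le⟩, hyx⟩

lemma lowerSemicontinuous_diam_compl_defeatedSet (hk : 0 < k) :
    LowerSemicontinuous fun a => Metric.diam (defeatedSet Z a)ᶜ := by
  intro a c hc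
  rcases lt_or_ge c 0 with hc0 | hc0
  · exact Filter.Eventually.of_forall fun b => hc0.trans_le Metric.diam_nonneg
  obtain ⟨x, hx, y, hy, hxy⟩ : ∃ x ∈ (defeatedSet Z a)ᶜ, ∃ y ∈ (defeatedSet Z a)ᶜ,
      c < dist x y := by
    by_contra! h
    exact absurd (Metric.diam_le_of_forall_dist_le hc0 h) (not_le.2 hc)
  have hε : 0 < (dist x y - c) / 2 := by linarith
  filter_upwards [eventually_exists_near_mem_compl_defeatedSet hx hε,
    eventually_exists_near_mem_compl_defeatedSet hy hε] with b ⟨x', hx', hxx'⟩ ⟨y', hy', hyy'⟩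
  have h1 := Metric.dist_le_diam_of_mem (isBounded_compl_defeatedSet hk b) hx' hy'
  have h2 := dist_triangle4 x x' y' y
  rw [dist_comm x x'] at h2
  change c < Metric.diam (defeatedSet Z b)ᶜ
  linarith

/-- If `a` is far from the origin then the complement of `defeatedSet Z a` contains both `0` and
`a`. The diameter is therefore coercive, and being lower semicontinuous it attains its minimum. -/
lemma exists_isTournamentMedian (hk : 0 < k) (Z : Fin k → EuclideanSpace ℝ (Fin d)) :
    ∃ a, IsTournamentMedian Z a := by
  have hD0 : 0 ≤ Metric.diam (defeatedSet Z 0)ᶜ := Metric.diam_nonneg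
  have hS0 : 0 ≤ ∑ j, ‖Z j‖ := Finset.sum_nonneg fun _ _ => norm_nonneg _
  obtain ⟨R, hR⟩ : ∃ R : ℝ, R = 2 * ∑ j, ‖Z j‖ + Metric.diam (defeatedSet Z 0)ᶜ := ⟨_, rfl⟩
  have hR0 : 0 ≤ R := by linarith
  have hmem : (0 : EuclideanSpace ℝ (Fin d)) ∈ Metric.closedBall 0 R :=
    Metric.mem_closedBall_self hR0
  obtain ⟨a, -, ha⟩ := LowerSemicontinuousOn.exists_isMinOn ⟨0, hmem⟩ (isCompact_closedBall _ _)
    ((lowerSemicontinuous_diam_compl_defeatedSet (Z := Z) hk).lowerSemicontinuousOn _)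
  refine ⟨a, fun b => ?_⟩
  by_cases hb : b ∈ Metric.closedBall 0 R
  · exact ha hb
  have hb' : R < ‖b‖ := by simpa using hb
  have h0 : (0 : EuclideanSpace ℝ (Fin d)) ∈ (defeatedSet Z b)ᶜ :=
    mem_compl_defeatedSet.2 ⟨Finset.univ, by simp; omega, fun j _ => by
      have h1 : ‖Z j‖ ≤ ∑ j, ‖Z j‖ :=
        Finset.single_le_sum (f := fun j => ‖Z j‖) (fun _ _ => norm_nonneg _) (Finset.mem_univ j)
      have h2 := norm_sub_norm_le b (Z j)
      rw [norm_sub_rev] at h2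
      rw [sub_zero]
      linarith⟩
  have h1 := Metric.dist_le_diam_of_mem (isBounded_compl_defeatedSet hk b)
    (self_mem_compl_defeatedSet b) h0
  rw [dist_zero_right] at h1
  have h2 : Metric.diam (defeatedSet Z a)ᶜ ≤ Metric.diam (defeatedSet Z 0)ᶜ := ha hmem
  linarith

/-- If `μ` defeats every point at distance more than `r`, every minimizer is within `2 * r`
of `μ`. -/
lemma IsTournamentMedian.norm_sub_le (hk : 0 < k) {a μ : EuclideanSpace ℝ (Fin d)} {r : ℝ}
    (hr : 0 ≤ r) (hμ : ∀ b, r < ‖b - μ‖ → b ∈ defeatedSet Z μ) (ha : IsTournamentMedian Z a) :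
    ‖a - μ‖ ≤ 2 * r := by
  have hsub : (defeatedSet Z μ)ᶜ ⊆ Metric.closedBall μ r := fun b hb => by
    by_contra h
    exact hb (hμ b (by simpa [dist_eq_norm] using h))
  by_cases hμa : μ ∈ defeatedSet Z a
  · have := hsub (mem_compl_defeatedSet_of_mem hμa)
    rw [mem_closedBall_iff_norm] at this
    linarith
  · calc ‖a - μ‖ = dist a μ := (dist_eq_norm _ _).symm
      _ ≤ Metric.diam (defeatedSet Z a)ᶜ :=
        Metric.dist_le_diam_of_mem (isBounded_compl_defeatedSet hk a)
          (self_mem_compl_defeatedSet a) hμa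
      _ ≤ Metric.diam (defeatedSet Z μ)ᶜ := ha μ
      _ ≤ Metric.diam (Metric.closedBall μ r) := Metric.diam_mono hsub Metric.isBounded_closedBall
      _ ≤ 2 * r := Metric.diam_closedBall hr

/-- If the projections of more than half of the `Z j - μ` on every unit vector are at most `r / 2`,
then `μ` defeats every point at distance more than `r`. -/
lemma mem_defeatedSet_of_card_lt {b μ : EuclideanSpace ℝ (Fin d)} {r : ℝ} (hr : 0 ≤ r)
    (h : ∀ u : EuclideanSpace ℝ (Fin d), ‖u‖ = 1 →
      ((Finset.univ.filter fun j => r / 2 < inner ℝ (Z j - μ) u).card : ℝ) < k / 2)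
    (hb : r < ‖b - μ‖) : b ∈ defeatedSet Z μ := by
  classical
  have hpos : 0 < ‖b - μ‖ := hr.trans_lt hb
  set u := ‖b - μ‖⁻¹ • (b - μ) with hu
  have hbu : b - μ = ‖b - μ‖ • u := by rw [hu, smul_smul, mul_inv_cancel₀ hpos.ne', one_smul]
  have hcard := h u (by rw [hu, norm_smul, norm_inv, norm_norm, inv_mul_cancel₀ hpos.ne'])
  refine ⟨Finset.univ.filter fun j => ¬ r / 2 < inner ℝ (Z j - μ) u, ?_, fun j hj => ?_⟩
  · have hsum := Finset.card_filter_add_card_filter_not (s := (Finset.univ : Finset (Fin k)))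
      (fun j => r / 2 < inner ℝ (Z j - μ) u)
    simp only [Finset.card_univ, Fintype.card_fin] at hsum
    have hsum' : ((Finset.univ.filter fun j => r / 2 < inner ℝ (Z j - μ) u).card : ℝ) +
      ((Finset.univ.filter fun j => ¬ r / 2 < inner ℝ (Z j - μ) u).card : ℝ) = k := by
      exact_mod_cast hsum
    linarith
  · have hj' : inner ℝ (Z j - μ) u ≤ r / 2 := by simpa using hj
    rw [sub_pos]
    refine lt_of_pow_lt_pow_left₀ 2 (norm_nonneg _) ?_
    have h1 : Z j - b = (Z j - μ) - (b - μ) := by abel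
    have h2 : inner ℝ (Z j - μ) (b - μ) = ‖b - μ‖ * inner ℝ (Z j - μ) u := by
      conv_lhs => rw [hbu]
      rw [inner_smul_right]
    rw [h1, norm_sub_sq_real (Z j - μ) (b - μ), h2]
    nlinarith

end Tournament

/-! ### The standard Gaussian measure and its translates -/

section Gaussian

variable {E : Type*} [NormedAddCommGroup E] [InnerProductSpace ℝ E] [FiniteDimensional ℝ E]
  [MeasurableSpace E] [BorelSpace E]

lemma integrable_exp_neg_sq_norm_half :
    Integrable (fun v : E => Real.exp (-‖v‖ ^ 2 / 2)) := by
  refine .of_integral_ne_zero ?_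
  have := GaussianFourier.integral_rexp_neg_mul_sq_norm (V := E) (b := 1 / 2) (by norm_num)
  simp_rw [show ∀ v : E, -‖v‖ ^ 2 / 2 = -(1 / 2) * ‖v‖ ^ 2 from fun v => by ring]
  rw [this]
  positivity

/-- The density of the standard Gaussian measure with respect to Lebesgue measure. -/
lemma stdGaussian_eq_tilted :
    stdGaussian E = (volume : Measure E).tilted fun v => -‖v‖ ^ 2 / 2 := by
  have := isProbabilityMeasure_tilted (integrable_exp_neg_sq_norm_half (E := E))
  refine Measure.ext_of_charFun (funext fun t => ?_)
  have h1 := GaussianFourier.integral_rexp_neg_mul_sq_norm (V := E) (b := 1 / 2) (by norm_num)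
  have h2 := GaussianFourier.integral_cexp_neg_mul_sq_norm_add (V := E) (b := (1 / 2 : ℂ))
    (by norm_num) Complex.I t
  have h3 := GaussianFourier.integral_cexp_neg_mul_sq_norm (V := E) (b := (1 / 2 : ℂ))
    (by norm_num)
  have h0 : (∫ v : E, Real.exp (-(1 / 2) * ‖v‖ ^ 2)) ≠ 0 := by
    rw [h1]; positivity
  have h4 : ((∫ v : E, Real.exp (-(1 / 2) * ‖v‖ ^ 2) : ℝ) : ℂ)
      = (Real.pi / (1 / 2 : ℂ)) ^ (Module.finrank ℝ E / 2 : ℂ) := by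
    rw [← h3, ← integral_complex_ofReal]
    push_cast
    rfl
  rw [charFun_stdGaussian, charFun_apply, integral_tilted]
  simp_rw [show ∀ v : E, -‖v‖ ^ 2 / 2 = -(1 / 2) * ‖v‖ ^ 2 from fun v => by ring]
  set c := ∫ v : E, Real.exp (-(1 / 2) * ‖v‖ ^ 2) with hc
  have h5 : ∀ v : E, (Real.exp (-(1 / 2) * ‖v‖ ^ 2) / c) • Complex.exp (inner ℝ v t * Complex.I)
      = (c : ℂ)⁻¹ * Complex.exp (-(1 / 2) * ‖v‖ ^ 2 + Complex.I * inner ℝ t v) := fun v => by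
    rw [Complex.exp_add, real_inner_comm v t, Complex.real_smul]
    push_cast
    rw [mul_comm (Complex.I)]
    ring
  simp_rw [h5]
  rw [integral_const_mul, h2, ← h4, ← mul_assoc, inv_mul_cancel₀ (by exact_mod_cast h0), one_mul,
    Complex.I_sq]
  congr 1
  ring

/-- The Cameron–Martin formula for the standard Gaussian measure. -/
lemma lintegral_stdGaussian_eq_lintegral_shift (F : E → ENNReal) (h : E) :
    ∫⁻ v, F v ∂(stdGaussian E) =
      ∫⁻ v, ENNReal.ofReal (Real.exp (-inner ℝ h v - ‖h‖ ^ 2 / 2)) * F (v + h)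
        ∂(stdGaussian E) := by
  rw [stdGaussian_eq_tilted, lintegral_tilted, lintegral_tilted,
    ← lintegral_add_right_eq_self _ h]
  refine lintegral_congr fun v => ?_
  rw [← mul_assoc, ← ENNReal.ofReal_mul (by positivity), div_mul_eq_mul_div, ← Real.exp_add,
    norm_add_sq_real, real_inner_comm]
  congr 4
  ring

lemma integrable_inner_stdGaussian (h : E) :
    Integrable (fun v => inner ℝ h v) (stdGaussian E) :=
  (IsGaussian.integrable_id (μ := stdGaussian E)).const_inner h

lemma integral_inner_stdGaussian (h : E) : ∫ v, inner ℝ h v ∂(stdGaussian E) = 0 := by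
  rw [integral_inner (f := fun v => v) (IsGaussian.integrable_id (μ := stdGaussian E)),
    integral_id_stdGaussian, inner_zero_right]

/-- Change of measure from a standard Gaussian to its translate by `h`, whose relative entropy is
`‖h‖ ^ 2 / 2`. -/
lemma exp_integral_shift_sub_le {f : E → ℝ} (h : E)
    (hf : Integrable (fun v => f (v + h)) (stdGaussian E)) :
    ENNReal.ofReal (Real.exp (∫ v, f (v + h) ∂(stdGaussian E) - ‖h‖ ^ 2 / 2)) ≤
      ∫⁻ v, ENNReal.ofReal (Real.exp (f v)) ∂(stdGaussian E) := by
  set a := ∫ v, f (v + h) ∂(stdGaussian E) - ‖h‖ ^ 2 / 2 with ha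
  obtain ⟨g, hg⟩ : ∃ g : E → ℝ, ∀ v, g v = f (v + h) - inner ℝ h v - ‖h‖ ^ 2 / 2 :=
    ⟨_, fun _ => rfl⟩
  have hfi := hf.sub (integrable_inner_stdGaussian h)
  have hgi : Integrable g (stdGaussian E) := by
    rw [funext hg]
    exact hfi.sub (integrable_const _)
  have hga : ∫ v, g v ∂(stdGaussian E) = a := by
    simp_rw [hg]
    rw [integral_sub (f := fun v => f (v + h) - inner ℝ h v) hfi (integrable_const _),
      integral_sub hf (integrable_inner_stdGaussian h), integral_inner_stdGaussian]
    simp [ha]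
  -- `exp a` is the integral of the tangent line of `exp` at `a`, evaluated at `g`.
  have htan : ∫ v, Real.exp a * (1 - a + g v) ∂(stdGaussian E) = Real.exp a := by
    rw [integral_const_mul, integral_add (integrable_const _) hgi, hga]
    simp
  have hti : Integrable (fun v => Real.exp a * (1 - a + g v)) (stdGaussian E) :=
    ((integrable_const _).add hgi).const_mul _
  rw [lintegral_stdGaussian_eq_lintegral_shift _ h, ← htan,
    integral_eq_lintegral_pos_part_sub_lintegral_neg_part hti]
  refine (ENNReal.ofReal_le_ofReal (sub_le_self _ ENNReal.toReal_nonneg)).trans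
    (ENNReal.ofReal_toReal_le.trans (lintegral_mono fun v => ?_))
  rw [← ENNReal.ofReal_mul (by positivity), ← Real.exp_add]
  refine ENNReal.ofReal_le_ofReal ?_
  rw [show -inner ℝ h v - ‖h‖ ^ 2 / 2 + f (v + h) = a + (g v - a) by rw [hg]; ring, Real.exp_add]
  refine mul_le_mul_of_nonneg_left ?_ (Real.exp_pos a).le
  linarith [Real.add_one_le_exp (g v - a)]

/-- A halfspace bounded by a hyperplane through the origin has Gaussian measure at least `1 / 2`. -/
lemma half_le_stdGaussian_real_inner_nonneg (w : E) :
    1 / 2 ≤ (stdGaussian E).real {v | 0 ≤ inner ℝ w v} := by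
  have hneg : (stdGaussian E).real {v | inner ℝ w v ≤ 0} =
      (stdGaussian E).real {v | 0 ≤ inner ℝ w v} := by
    have hmap := stdGaussian_map (E := E) (LinearIsometryEquiv.neg ℝ)
    conv_lhs => rw [← hmap]
    rw [map_measureReal_apply (by fun_prop) (measurableSet_le (by fun_prop) (by fun_prop))]
    simp
  have hun : (stdGaussian E).real Set.univ ≤ (stdGaussian E).real {v | inner ℝ w v ≤ 0} +
      (stdGaussian E).real {v | 0 ≤ inner ℝ w v} := by
    refine le_trans (measureReal_mono ?_) (measureReal_union_le _ _)
    intro v _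
    exact le_total (inner ℝ w v) 0
  rw [probReal_univ, hneg] at hun
  linarith

end Gaussian

/-! ### A PAC-Bayesian deviation inequality -/

section PACBayes

variable {E : Type*} [NormedAddCommGroup E] [InnerProductSpace ℝ E] [FiniteDimensional ℝ E]
  [MeasurableSpace E] [BorelSpace E] {Ω : Type*} [MeasurableSpace Ω]

/-- If every `exp (f · v)` has mean at most `1`, then outside an event of probability at most
`δ` the Gaussian averages of `f ω` around all points `h` are bounded simultaneously. The averaging replaces
a union bound over `h`. -/
lemma exists_event_integral_shift_le (P : Measure Ω) [IsProbabilityMeasure P] {f : Ω → E → ℝ}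
    (hf : Measurable (Function.uncurry f))
    (hexp : ∀ v, ∫⁻ ω, ENNReal.ofReal (Real.exp (f ω v)) ∂P ≤ 1) {δ : ℝ} (hδ : 0 < δ) :
    ∃ A : Set Ω, MeasurableSet A ∧ ENNReal.ofReal (1 - δ) ≤ P A ∧
      ∀ ω ∈ A, ∀ h, Integrable (fun v => f ω (v + h)) (stdGaussian E) →
        ∫ v, f ω (v + h) ∂(stdGaussian E) ≤ ‖h‖ ^ 2 / 2 + Real.log (1 / δ) := by
  set G : Ω → ENNReal := fun ω => ∫⁻ v, ENNReal.ofReal (Real.exp (f ω v)) ∂(stdGaussian E) with hG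
  have hfm : Measurable fun p : Ω × E => ENNReal.ofReal (Real.exp (f p.1 p.2)) :=
    (Real.measurable_exp.comp hf).ennreal_ofReal
  have hGm : Measurable G := hfm.lintegral_prod_right'
  have hG1 : ∫⁻ ω, G ω ∂P ≤ 1 := by
    rw [hG, lintegral_lintegral_swap hfm.aemeasurable]
    calc _ ≤ ∫⁻ _ : E, 1 ∂(stdGaussian E) := lintegral_mono hexp
      _ = 1 := by simp
  have hA : MeasurableSet {ω | G ω ≤ ENNReal.ofReal (1 / δ)} := measurableSet_le hGm measurable_const
  refine ⟨{ω | G ω ≤ ENNReal.ofReal (1 / δ)}, hA, ?_, fun ω hω h hint => ?_⟩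
  · have hmk := mul_meas_ge_le_lintegral hGm (μ := P) (ENNReal.ofReal (1 / δ))
    have hc : P {ω | G ω ≤ ENNReal.ofReal (1 / δ)}ᶜ ≤ ENNReal.ofReal δ := by
      calc P {ω | G ω ≤ ENNReal.ofReal (1 / δ)}ᶜ
          ≤ P {ω | ENNReal.ofReal (1 / δ) ≤ G ω} :=
            measure_mono fun ω hω => (not_le.1 (show ¬ G ω ≤ _ from hω)).le
        _ = ENNReal.ofReal δ * (ENNReal.ofReal (1 / δ) * P {ω | ENNReal.ofReal (1 / δ) ≤ G ω}) := by
            rw [← mul_assoc, ← ENNReal.ofReal_mul hδ.le, mul_one_div_cancel hδ.ne',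
              ENNReal.ofReal_one, one_mul]
        _ ≤ ENNReal.ofReal δ * 1 := by gcongr; exact hmk.trans hG1
        _ = ENNReal.ofReal δ := mul_one _
    rw [ENNReal.ofReal_sub _ hδ.le, ENNReal.ofReal_one, tsub_le_iff_right,
      ← prob_add_prob_compl (μ := P) hA]
    gcongr
  · have h1 := (exp_integral_shift_sub_le h hint).trans hω
    rw [ENNReal.ofReal_le_ofReal_iff (by positivity), ← Real.le_log_iff_exp_le (by positivity)] at h1
    linarith

/-- Uniform control of the number of independent vectors with a large projection. The indicator of
`c < ⟪Y, h⟫` is at most twice the Gaussian average of the indicators of `c < ⟪Y, v + h⟫`, because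
half of the `v` do not decrease the projection. -/
lemma exists_event_card_le (P : Measure Ω) [IsProbabilityMeasure P] {k : ℕ} {Y : Fin k → Ω → E}
    (hY : ∀ j, Measurable (Y j)) (hind : iIndepFun Y P) {c : ℝ} {q : E → ℝ} (hq : Measurable q)
    (hp : ∀ j v, P.real {ω | c < inner ℝ (Y j ω) v} ≤ q v) {δ : ℝ} (hδ : 0 < δ) :
    ∃ A : Set Ω, MeasurableSet A ∧ ENNReal.ofReal (1 - δ) ≤ P A ∧
      ∀ ω ∈ A, ∀ h, Integrable (fun v => q (v + h)) (stdGaussian E) →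
        ((Finset.univ.filter fun j => c < inner ℝ (Y j ω) h).card : ℝ) ≤
          ‖h‖ ^ 2 + 2 * Real.log (1 / δ) +
            2 * (Real.exp 1 - 1) * k * ∫ v, q (v + h) ∂(stdGaussian E) := by
  have he : 0 ≤ Real.exp 1 - 1 := by linarith [Real.add_one_le_exp 1]
  set g : E → E → ℝ := fun v y => Set.indicator {y | c < inner ℝ y v} 1 y with hg
  have hgm : ∀ v, Measurable (g v) := fun v =>
    measurable_one.indicator (measurableSet_lt measurable_const (by fun_prop))
  have hg01 : ∀ v y, 0 ≤ g v y ∧ g v y ≤ 1 := fun v y => by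
    by_cases h : c < inner ℝ y v <;> simp [hg, h]
  have hgjm : ∀ j, Measurable fun p : Ω × E => g p.2 (Y j p.1) := fun j => by
    have : (fun p : Ω × E => g p.2 (Y j p.1)) =
        Set.indicator {p : Ω × E | c < inner ℝ (Y j p.1) p.2} 1 := by
      ext p; simp [hg, Set.indicator]
    rw [this]
    exact measurable_one.indicator (measurableSet_lt measurable_const
      (((hY j).comp measurable_fst).inner measurable_snd))
  set f : Ω → E → ℝ := fun ω v => ∑ j, g v (Y j ω) - (Real.exp 1 - 1) * k * q v with hf
  have hfm : Measurable (Function.uncurry f) :=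
    (Finset.measurable_sum _ fun j _ => hgjm j).sub
      ((hq.comp measurable_snd).const_mul _)
  have hexp : ∀ v, ∫⁻ ω, ENNReal.ofReal (Real.exp (f ω v)) ∂P ≤ 1 := fun v => by
    have hfac : ∀ j, ∫ ω, Real.exp (g v (Y j ω)) ∂P ≤ Real.exp ((Real.exp 1 - 1) * q v) :=
        fun j => by
      have hset : MeasurableSet {ω | c < inner ℝ (Y j ω) v} :=
        measurableSet_lt measurable_const ((hY j).inner measurable_const)
      have : ∀ ω, Real.exp (g v (Y j ω)) =
          1 + (Real.exp 1 - 1) * Set.indicator {ω | c < inner ℝ (Y j ω) v} 1 ω := fun ω => by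
        by_cases h : c < inner ℝ (Y j ω) v <;> simp [hg, h]
      simp_rw [this]
      have hi : Integrable (fun ω => (Real.exp 1 - 1) *
          Set.indicator {ω | c < inner ℝ (Y j ω) v} (1 : Ω → ℝ) ω) P :=
        ((integrable_const (1 : ℝ)).indicator hset).const_mul _
      rw [integral_add (integrable_const _) hi, integral_const_mul, integral_indicator_one hset]
      have h1 := Real.add_one_le_exp ((Real.exp 1 - 1) * q v)
      have h2 := mul_le_mul_of_nonneg_left (hp j v) he
      simp only [integral_const, probReal_univ, smul_eq_mul, one_mul]
      linarith
    have hprod : ∫ ω, Real.exp (f ω v) ∂P ≤ 1 := by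
      have : ∀ ω, Real.exp (f ω v) =
          (∏ j, Real.exp (g v (Y j ω))) * Real.exp (-((Real.exp 1 - 1) * k * q v)) := fun ω => by
        rw [← Real.exp_sum, ← Real.exp_add, ← sub_eq_add_neg]
      simp_rw [this]
      have hprod : ∫ ω, ∏ j, Real.exp (g v (Y j ω)) ∂P = ∏ j, ∫ ω, Real.exp (g v (Y j ω)) ∂P :=
        hind.integral_fun_prod_comp (fun j => (hY j).aemeasurable)
          (f := fun _ y => Real.exp (g v y))
          fun j => (Real.measurable_exp.comp (hgm v)).aestronglyMeasurable
      rw [integral_mul_const, hprod]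
      calc _ ≤ (∏ _j : Fin k, Real.exp ((Real.exp 1 - 1) * q v)) *
            Real.exp (-((Real.exp 1 - 1) * k * q v)) := by
            refine mul_le_mul_of_nonneg_right ?_ (Real.exp_pos _).le
            exact Finset.prod_le_prod (fun j _ => integral_nonneg fun _ => (Real.exp_pos _).le)
              fun j _ => hfac j
        _ = 1 := by
            rw [Finset.prod_const, Finset.card_univ, Fintype.card_fin, ← Real.exp_nat_mul,
              ← Real.exp_add, Real.exp_eq_one_iff]
            ring
    have hfv : Measurable fun ω => f ω v := hfm.comp (measurable_id.prodMk measurable_const)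
    rw [← ofReal_integral_eq_lintegral_ofReal ?_ (ae_of_all _ fun _ => (Real.exp_pos _).le)]
    · exact (ENNReal.ofReal_le_ofReal hprod).trans (by simp)
    · refine Integrable.of_bound (Real.measurable_exp.comp hfv).aestronglyMeasurable
        (Real.exp (k - (Real.exp 1 - 1) * k * q v)) (ae_of_all _ fun ω => ?_)
      rw [Real.norm_eq_abs, Real.abs_exp, Real.exp_le_exp]
      refine sub_le_sub_right ((Finset.sum_le_sum fun j _ => (hg01 v (Y j ω)).2).trans ?_) _
      simp
  obtain ⟨A, hA, hPA, hbound⟩ := exists_event_integral_shift_le P hfm hexp hδ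
  refine ⟨A, hA, hPA, fun ω hω h hqi => ?_⟩
  have hgi : ∀ j, Integrable (fun v => g (v + h) (Y j ω)) (stdGaussian E) := fun j =>
    Integrable.of_bound ((hgjm j).comp (measurable_const.prodMk
      (measurable_id.add_const h))).aestronglyMeasurable 1 (ae_of_all _ fun v => by
        rw [Real.norm_of_nonneg (hg01 _ _).1]; exact (hg01 _ _).2)
  have hsi := integrable_finsetSum Finset.univ fun j _ => hgi j
  have hint := hbound ω hω h (hsi.sub (hqi.const_mul _))
  rw [integral_sub hsi (hqi.const_mul _), integral_finsetSum _ fun j _ => hgi j,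
    integral_const_mul] at hint
  have hhalf : ((Finset.univ.filter fun j => c < inner ℝ (Y j ω) h).card : ℝ) / 2 ≤
      ∑ j, ∫ v, g (v + h) (Y j ω) ∂(stdGaussian E) := by
    rw [Finset.card_filter, Nat.cast_sum, Finset.sum_div]
    refine Finset.sum_le_sum fun j _ => ?_
    split_ifs with hj
    · have hset : MeasurableSet {v : E | 0 ≤ inner ℝ (Y j ω) v} :=
        measurableSet_le measurable_const (by fun_prop)
      rw [Nat.cast_one]
      refine (half_le_stdGaussian_real_inner_nonneg (Y j ω)).trans ?_
      rw [← integral_indicator_one hset]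
      refine integral_mono ((integrable_const (1 : ℝ)).indicator hset) (hgi j) fun v => ?_
      by_cases hv : 0 ≤ inner ℝ (Y j ω) v
      · have : c < inner ℝ (Y j ω) (v + h) := by rw [inner_add_right]; linarith
        simp [hg, hv, this]
      · simpa [hv] using (hg01 (v + h) (Y j ω)).1
    · simpa using integral_nonneg fun v => (hg01 (v + h) (Y j ω)).1
  linarith

end PACBayes

/-! ### The covariance matrix as a quadratic form -/

section Covariance

variable {d : ℕ} {ν : Measure (EuclideanSpace ℝ (Fin d))}

lemma memLp_coord (hν : MemLp id 2 ν) (p : Fin d) :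
    MemLp (fun x : EuclideanSpace ℝ (Fin d) => x p) 2 ν :=
  (EuclideanSpace.proj p : EuclideanSpace ℝ (Fin d) →L[ℝ] ℝ).comp_memLp' hν

lemma memLp_inner (hν : MemLp id 2 ν) (v : EuclideanSpace ℝ (Fin d)) :
    MemLp (fun x => inner ℝ x v) 2 ν := by
  simp_rw [real_inner_comm v]
  exact (innerSL ℝ v).comp_memLp' hν

lemma integral_inner_eq_inner_meanVec [IsProbabilityMeasure ν] (hν : MemLp id 2 ν)
    (v : EuclideanSpace ℝ (Fin d)) : ∫ x, inner ℝ x v ∂ν = inner ℝ (meanVec ν) v := by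
  simp_rw [real_inner_comm v]
  exact integral_inner (f := fun x => x) (hν.integrable one_le_two) v

lemma covarianceMatrix_apply [IsProbabilityMeasure ν] (hν : MemLp id 2 ν) (p q : Fin d) :
    covarianceMatrix ν p q = cov[fun x => x p, fun x => x q; ν] := by
  have h : ∀ p, ∫ x, x p ∂ν = meanVec ν p := fun p =>
    (EuclideanSpace.proj p : EuclideanSpace ℝ (Fin d) →L[ℝ] ℝ).integral_comp_comm
      (φ := fun x => x) (hν.integrable one_le_two)
  simp [covarianceMatrix, covariance, h]

lemma variance_inner_eq_sum [IsProbabilityMeasure ν] (hν : MemLp id 2 ν)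
    (v : EuclideanSpace ℝ (Fin d)) :
    Var[fun x => inner ℝ x v; ν] = ∑ p, ∑ q, v p * (covarianceMatrix ν p q * v q) := by
  have h : (fun x : EuclideanSpace ℝ (Fin d) => inner ℝ x v) = fun x => ∑ p, v p * x p := by
    ext x
    simp [PiLp.inner_apply]
  rw [h, variance_fun_sum fun p => (memLp_coord hν p).const_mul _]
  refine Finset.sum_congr rfl fun p _ => Finset.sum_congr rfl fun q _ => ?_
  rw [covariance_const_mul_left, covariance_const_mul_right, covarianceMatrix_apply hν,
    mul_comm (v q)]

lemma continuous_variance_inner [IsProbabilityMeasure ν] (hν : MemLp id 2 ν) :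
    Continuous fun v => Var[fun x => inner ℝ x v; ν] := by
  simp_rw [variance_inner_eq_sum hν]
  fun_prop

lemma variance_inner_add_le [IsProbabilityMeasure ν] (hν : MemLp id 2 ν)
    (v w : EuclideanSpace ℝ (Fin d)) :
    Var[fun x => inner ℝ x (v + w); ν] ≤
      2 * Var[fun x => inner ℝ x v; ν] + 2 * Var[fun x => inner ℝ x w; ν] := by
  simp_rw [inner_add_right]
  have h1 := variance_fun_add (memLp_inner hν v) (memLp_inner hν w)
  have h2 := variance_fun_sub (memLp_inner hν v) (memLp_inner hν w)
  have h3 := variance_nonneg (fun x => inner ℝ x v - inner ℝ x w) ν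
  linarith

lemma memLp_coord_stdGaussian (p : Fin d) :
    MemLp (fun v => v p) 2 (stdGaussian (EuclideanSpace ℝ (Fin d))) :=
  memLp_coord IsGaussian.memLp_two_id p

lemma integral_mul_coord_stdGaussian (p q : Fin d) :
    ∫ v, v p * v q ∂(stdGaussian (EuclideanSpace ℝ (Fin d))) = (1 : Matrix _ _ ℝ) p q := by
  have h0 : ∀ p : Fin d, ∫ v, v p ∂(stdGaussian (EuclideanSpace ℝ (Fin d))) = 0 := fun p =>
    integral_strongDual_stdGaussian (EuclideanSpace.proj p : EuclideanSpace ℝ (Fin d) →L[ℝ] ℝ)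
  have h := covariance_eval_multivariateGaussian (μ := (0 : EuclideanSpace ℝ (Fin d)))
    Matrix.PosSemidef.one p q
  rw [multivariateGaussian_zero_one] at h
  rw [← h, covariance, h0, h0]
  simp

lemma integrable_variance_inner_stdGaussian [IsProbabilityMeasure ν] (hν : MemLp id 2 ν) :
    Integrable (fun v => Var[fun x => inner ℝ x v; ν])
      (stdGaussian (EuclideanSpace ℝ (Fin d))) := by
  simp_rw [variance_inner_eq_sum hν, mul_left_comm]
  exact integrable_finsetSum _ fun p _ => integrable_finsetSum _ fun q _ =>
    ((memLp_coord_stdGaussian p).integrable_mul (memLp_coord_stdGaussian q)).const_mul _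

lemma integral_variance_inner_stdGaussian [IsProbabilityMeasure ν] (hν : MemLp id 2 ν) :
    ∫ v, Var[fun x => inner ℝ x v; ν] ∂(stdGaussian (EuclideanSpace ℝ (Fin d))) =
      (covarianceMatrix ν).trace := by
  have hi : ∀ p q : Fin d, Integrable (fun v => covarianceMatrix ν p q * (v p * v q))
      (stdGaussian (EuclideanSpace ℝ (Fin d))) := fun p q =>
    ((memLp_coord_stdGaussian p).integrable_mul (memLp_coord_stdGaussian q)).const_mul _
  simp_rw [variance_inner_eq_sum hν, mul_left_comm]
  rw [integral_finsetSum _ fun p _ => integrable_finsetSum _ fun q _ => hi p q]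
  simp_rw [integral_finsetSum _ fun q _ => hi _ q, integral_const_mul,
    integral_mul_coord_stdGaussian, Matrix.one_apply]
  simp [Matrix.trace]

lemma integrable_variance_inner_shift [IsProbabilityMeasure ν] (hν : MemLp id 2 ν)
    (h : EuclideanSpace ℝ (Fin d)) :
    Integrable (fun v => Var[fun x => inner ℝ x (v + h); ν])
      (stdGaussian (EuclideanSpace ℝ (Fin d))) := by
  refine Integrable.mono' (((integrable_variance_inner_stdGaussian hν).const_mul 2).add
    (integrable_const (2 * Var[fun x => inner ℝ x h; ν])))
    ((continuous_variance_inner hν).comp (continuous_add_const h)).aestronglyMeasurable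
    (ae_of_all _ fun v => ?_)
  rw [Real.norm_of_nonneg (variance_nonneg _ _)]
  exact variance_inner_add_le hν v h

lemma integral_variance_inner_shift_le [IsProbabilityMeasure ν] (hν : MemLp id 2 ν)
    (h : EuclideanSpace ℝ (Fin d)) :
    ∫ v, Var[fun x => inner ℝ x (v + h); ν] ∂(stdGaussian (EuclideanSpace ℝ (Fin d))) ≤
      2 * (covarianceMatrix ν).trace + 2 * Var[fun x => inner ℝ x h; ν] := by
  have hi := (integrable_variance_inner_stdGaussian hν).const_mul 2
  refine (integral_mono (integrable_variance_inner_shift hν h) (hi.add (integrable_const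
    (2 * Var[fun x => inner ℝ x h; ν]))) fun v => variance_inner_add_le hν v h).trans_eq ?_
  simp only [Pi.add_apply]
  rw [integral_add hi (integrable_const _), integral_const_mul,
    integral_variance_inner_stdGaussian hν]
  simp

/-- The Rayleigh quotient of a symmetric matrix is at most its largest eigenvalue. -/
lemma inner_toEuclideanLin_le_lambdaMax {A : Matrix (Fin d) (Fin d) ℝ} (hA : A.IsHermitian)
    (v : EuclideanSpace ℝ (Fin d)) :
    inner ℝ (Matrix.toEuclideanLin A v) v ≤ lambdaMax A * ‖v‖ ^ 2 := by
  rcases eq_or_ne v 0 with rfl | hv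
  · simp
  have : Nontrivial (EuclideanSpace ℝ (Fin d)) := ⟨v, 0, hv⟩
  have hT : (Matrix.toEuclideanLin A).IsSymmetric := Matrix.isSymmetric_toEuclideanLin_iff.2 hA
  obtain ⟨w, hw⟩ := hT.hasEigenvalue_iSup_of_finiteDimensional.exists_hasEigenvector
  set M : ℝ := ⨆ x : {x : EuclideanSpace ℝ (Fin d) // x ≠ 0},
    RCLike.re (inner ℝ (Matrix.toEuclideanLin A x) (x : EuclideanSpace ℝ (Fin d))) /
      ‖(x : EuclideanSpace ℝ (Fin d))‖ ^ 2 with hM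
  have hMeig : Module.End.HasEigenvalue (Matrix.toLin' A) M := by
    refine Module.End.hasEigenvalue_of_hasEigenvector (x := WithLp.ofLp w)
      (Module.End.hasEigenvector_iff.2 ⟨Module.End.mem_eigenspace_iff.2 ?_, fun h => hw.2 ?_⟩)
    · have := congrArg WithLp.ofLp hw.apply_eq_smul
      simpa [Matrix.toLin'_apply] using this
    · exact WithLp.ofLp_injective 2 h
  have hle : M ≤ lambdaMax A := le_csSup (Module.End.finite_hasEigenvalue _).bddAbove hMeig
  have hbdd : BddAbove (Set.range fun x : {x : EuclideanSpace ℝ (Fin d) // x ≠ 0} =>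
      RCLike.re (inner ℝ (Matrix.toEuclideanLin A x) (x : EuclideanSpace ℝ (Fin d))) /
        ‖(x : EuclideanSpace ℝ (Fin d))‖ ^ 2) := by
    refine ⟨‖(Matrix.toEuclideanLin A).toContinuousLinearMap‖, ?_⟩
    rintro _ ⟨⟨x, hx⟩, rfl⟩
    have hx' : 0 < ‖x‖ := norm_pos_iff.2 hx
    change RCLike.re (inner ℝ (Matrix.toEuclideanLin A x) x) / ‖x‖ ^ 2 ≤ _
    rw [div_le_iff₀ (by positivity)]
    have h1 := real_inner_le_norm (Matrix.toEuclideanLin A x) x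
    have h2 := (Matrix.toEuclideanLin A).toContinuousLinearMap.le_opNorm x
    have h3 : ‖Matrix.toEuclideanLin A x‖ ≤
      ‖(Matrix.toEuclideanLin A).toContinuousLinearMap‖ * ‖x‖ := h2
    calc _ ≤ ‖Matrix.toEuclideanLin A x‖ * ‖x‖ := h1
      _ ≤ _ * ‖x‖ * ‖x‖ := by gcongr
      _ = _ := by ring
  have hv' : 0 < ‖v‖ := norm_pos_iff.2 hv
  have hvM : inner ℝ (Matrix.toEuclideanLin A v) v / ‖v‖ ^ 2 ≤ M := le_ciSup hbdd ⟨v, hv⟩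
  rw [div_le_iff₀ (by positivity)] at hvM
  exact hvM.trans (by gcongr)

lemma variance_inner_le_lambdaMax [IsProbabilityMeasure ν] (hν : MemLp id 2 ν)
    (v : EuclideanSpace ℝ (Fin d)) :
    Var[fun x => inner ℝ x v; ν] ≤ lambdaMax (covarianceMatrix ν) * ‖v‖ ^ 2 := by
  have hA : (covarianceMatrix ν).IsHermitian := by
    ext p q
    simp [covarianceMatrix, mul_comm]
  refine le_trans (le_of_eq ?_) (inner_toEuclideanLin_le_lambdaMax hA v)
  rw [variance_inner_eq_sum hν]
  simp [PiLp.inner_apply, Matrix.mulVec, dotProduct, Finset.mul_sum]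

lemma trace_covarianceMatrix_nonneg : 0 ≤ (covarianceMatrix ν).trace :=
  Finset.sum_nonneg fun _ _ => integral_nonneg fun _ => mul_self_nonneg _

end Covariance

/-! ### Block means of an independent sample -/

section Blocks

variable {Ω : Type*} [MeasurableSpace Ω] {P : Measure Ω}

/-- Functions of disjoint blocks of independent random variables are independent. -/
lemma iIndepFun_blocks {ι κ E F : Type*} [DecidableEq ι] [DecidableEq κ] [MeasurableSpace E]
    [MeasurableSpace F] {X : ι → Ω → E} (hX : ∀ i, Measurable (X i)) (hind : iIndepFun X P)
    {B : κ → Finset ι} (hB : ∀ j j', j ≠ j' → Disjoint (B j) (B j'))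
    {g : ∀ j, (B j → E) → F} (hg : ∀ j, Measurable (g j)) :
    iIndepFun (fun j ω => g j fun i => X i ω) P := by
  have := hind.isProbabilityMeasure
  rw [iIndepFun_iff_measure_inter_preimage_eq_mul]
  intro S
  induction S using Finset.induction_on with
  | empty => simp
  | insert j S hj ih =>
    intro s hs
    rw [Finset.set_biInter_insert, Finset.prod_insert hj,
      ← ih fun i hi => hs i (Finset.mem_insert_of_mem hi)]
    have hdisj : Disjoint (B j) (S.biUnion B) :=
      (Finset.disjoint_biUnion_right _ _ _).2 fun i hi =>
        hB j i fun h => hj (h ▸ hi)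
    have hi := indepFun_iff_measure_inter_preimage_eq_mul.1
      (hind.indepFun_finset _ _ hdisj hX) (g j ⁻¹' s j)
      (⋂ i : S, (fun x : S.biUnion B → E => g i fun l =>
        x ⟨l, Finset.mem_biUnion.2 ⟨i, i.2, l.2⟩⟩) ⁻¹' s i)
      (hg j (hs j (Finset.mem_insert_self _ _)))
      (MeasurableSet.iInter fun i =>
        ((hg i).comp (measurable_pi_lambda _ fun l => measurable_pi_apply _))
          (hs i (Finset.mem_insert_of_mem i.2)))
    convert hi using 3 <;> ext ω <;> simp

variable {d k N : ℕ} {ν : Measure (EuclideanSpace ℝ (Fin d))}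
  {X : Fin N → Ω → EuclideanSpace ℝ (Fin d)} {B : Fin k → Finset (Fin N)}

lemma measurable_blockMean (hX : ∀ i, Measurable (X i)) (j : Fin k) :
    Measurable fun ω => blockMean B (fun i => X i ω) j := by
  unfold blockMean
  fun_prop

lemma iIndepFun_blockMean (hX : ∀ i, Measurable (X i)) (hind : iIndepFun X P)
    (hB : IsEqualPartition B) : iIndepFun (fun j ω => blockMean B (fun i => X i ω) j) P := by
  have h := iIndepFun_blocks hX hind hB.disjoint
    (g := fun j x => ((B j).card : ℝ)⁻¹ • ∑ i, x i) fun j => by fun_prop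
  convert h using 3 with j ω
  rw [blockMean, Finset.sum_coe_sort (B j) fun i => X i ω]

lemma inner_blockMean (x : Fin N → EuclideanSpace ℝ (Fin d)) (j : Fin k)
    (v : EuclideanSpace ℝ (Fin d)) :
    inner ℝ (blockMean B x j) v = ((B j).card : ℝ)⁻¹ * ∑ i ∈ B j, inner ℝ (x i) v := by
  rw [blockMean, real_inner_smul_left, sum_inner]

lemma memLp_inner_sample (hν : MemLp id 2 ν) (hlaw : ∀ i, HasLaw (X i) ν P) (i : Fin N)
    (v : EuclideanSpace ℝ (Fin d)) : MemLp (fun ω => inner ℝ (X i ω) v) 2 P := by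
  have h := memLp_inner hν v
  rw [← (hlaw i).map_eq] at h
  exact h.comp_of_map (hlaw i).aemeasurable

lemma variance_inner_blockMean (hν : MemLp id 2 ν) (hlaw : ∀ i, HasLaw (X i) ν P)
    (hind : iIndepFun X P) (j : Fin k) (v : EuclideanSpace ℝ (Fin d)) :
    Var[fun ω => inner ℝ (blockMean B (fun i => X i ω) j) v; P] =
      Var[fun x => inner ℝ x v; ν] / (B j).card := by
  simp_rw [inner_blockMean]
  have hsum : (fun ω => ∑ i ∈ B j, inner ℝ (X i ω) v) =
      ∑ i ∈ B j, fun ω => inner ℝ (X i ω) v := by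
    ext ω; simp
  have hvar : ∀ i, Var[fun ω => inner ℝ (X i ω) v; P] = Var[fun x => inner ℝ x v; ν] := fun i => by
    rw [← (hlaw i).map_eq, variance_map (by fun_prop) (hlaw i).aemeasurable]
    rfl
  rw [variance_const_mul, hsum, IndepFun.variance_sum fun i _ => memLp_inner_sample hν hlaw i v]
  · simp_rw [hvar]
    rw [Finset.sum_const, nsmul_eq_mul]
    rcases eq_or_ne ((B j).card : ℝ) 0 with h | h
    · simp [h]
    · field_simp
  · intro i _ l _ hil
    exact (hind.comp (fun _ x => inner ℝ x v) fun _ => by fun_prop).indepFun hil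

variable [IsProbabilityMeasure ν] [IsProbabilityMeasure P]

lemma integral_inner_blockMean (hν : MemLp id 2 ν) (hlaw : ∀ i, HasLaw (X i) ν P) (j : Fin k)
    (hcard : (B j).card ≠ 0) (v : EuclideanSpace ℝ (Fin d)) :
    ∫ ω, inner ℝ (blockMean B (fun i => X i ω) j) v ∂P = inner ℝ (meanVec ν) v := by
  simp_rw [inner_blockMean]
  rw [integral_const_mul, integral_finsetSum _ fun i _ =>
    (memLp_inner_sample hν hlaw i v).integrable one_le_two]
  have h : ∀ i, ∫ ω, inner ℝ (X i ω) v ∂P = inner ℝ (meanVec ν) v := fun i => by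
    rw [← integral_inner_eq_inner_meanVec hν]
    exact (hlaw i).integral_comp (f := fun x => inner ℝ x v) (by fun_prop)
  simp_rw [h]
  rw [Finset.sum_const, nsmul_eq_mul, ← mul_assoc, inv_mul_cancel₀ (by exact_mod_cast hcard),
    one_mul]

/-- Chebyshev's inequality. For `c = 0` the right-hand side is zero, and the inequality holds when
the variance vanishes. -/
lemma measureReal_lt_sub_integral_le {f : Ω → ℝ} (hf : MemLp f 2 P) {c : ℝ} (hc : 0 ≤ c)
    (hf0 : c = 0 → Var[f; P] = 0) :
    P.real {ω | c < f ω - ∫ ω, f ω ∂P} ≤ Var[f; P] / c ^ 2 := by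
  rcases hc.eq_or_lt with rfl | hc
  · have hvar : evariance f P = 0 := by rw [← hf.ofReal_variance_eq, hf0 rfl, ENNReal.ofReal_zero]
    have hae := (evariance_eq_zero_iff hf.1.aemeasurable).1 hvar
    have h0 : P {ω | 0 < f ω - ∫ ω, f ω ∂P} = 0 := by
      refine measure_mono_null (fun ω hω => ?_) (ae_iff.1 hae)
      exact fun h : f ω = ∫ ω, f ω ∂P => absurd hω (by simp [h])
    rw [measureReal_def, h0]
    simp
  · refine ENNReal.toReal_le_of_le_ofReal (by have := variance_nonneg f P; positivity) ?_
    exact (measure_mono fun ω (hω : c < _) => hω.le.trans (le_abs_self _)).trans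
      (meas_ge_le_variance_div_sq hf hc)

end Blocks

/-! ### The deviation bound -/

section Deviation

variable {d N k : ℕ} {Ω : Type*} [MeasurableSpace Ω] {P : Measure Ω} [IsProbabilityMeasure P]

/-- On an event of probability at least `1 - δ`, the mean defeats every point at distance more
than `r`. The projections of the block means are averaged over Gaussian shifts of the direction
`s • u`, where `s ^ 2 = k / 10` balances the relative entropy `s ^ 2 / 2` against the variance that
the shifts add. -/
lemma exists_event_meanVec_defeats {δ r : ℝ} (hδ0 : 0 < δ) (hδ1 : δ < 1)
    (hk : k = ⌈360 * Real.log (2 / δ)⌉₊) (hN : 0 < N) (hkN : k ∣ N)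
    {B : Fin k → Finset (Fin N)} (hB : IsEqualPartition B)
    {ν : Measure (EuclideanSpace ℝ (Fin d))} [IsProbabilityMeasure ν] (hν : MemLp id 2 ν)
    {X : Fin N → Ω → EuclideanSpace ℝ (Fin d)} (hX : ∀ i, Measurable (X i))
    (hlaw : ∀ i, HasLaw (X i) ν P) (hindep : iIndepFun X P) (hr : 0 ≤ r)
    (hrT : 160000 * (covarianceMatrix ν).trace ≤ N * r ^ 2)
    (hrl : 57600 * (lambdaMax (covarianceMatrix ν) * Real.log (2 / δ)) ≤ N * r ^ 2) :
    ∃ A : Set Ω, MeasurableSet A ∧ ENNReal.ofReal (1 - δ) ≤ P A ∧ ∀ ω ∈ A, ∀ b,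
      r < ‖b - meanVec ν‖ → b ∈ defeatedSet (blockMean B fun i => X i ω) (meanVec ν) := by
  set T := (covarianceMatrix ν).trace with hT
  set l := lambdaMax (covarianceMatrix ν) with hl
  set L := Real.log (2 / δ) with hL
  set Q : EuclideanSpace ℝ (Fin d) → ℝ := fun v => Var[fun x => inner ℝ x v; ν] with hQ
  have hT0 : 0 ≤ T := trace_covarianceMatrix_nonneg
  have hQ0 : ∀ v, 0 ≤ Q v := fun v => variance_nonneg _ _
  have hL2 : 0.69 < L := by
    refine (by linarith [Real.log_two_gt_d9] : (0.69 : ℝ) < Real.log 2).trans_le ?_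
    exact Real.log_le_log two_pos ((le_div_iff₀ hδ0).2 (by linarith))
  have hLδ : Real.log (1 / δ) ≤ L :=
    Real.log_le_log (by positivity) (by gcongr; norm_num)
  have hkL : 360 * L ≤ k := hk ▸ Nat.le_ceil _
  have hkL' : (k : ℝ) ≤ 362 * L := by
    have := Nat.ceil_lt_add_one (a := 360 * L) (by linarith)
    rw [← hk] at this
    linarith
  have hk0 : (0 : ℝ) < k := by linarith
  have hN0 : (0 : ℝ) < N := by exact_mod_cast hN
  have hcard : ∀ j, ((B j).card : ℝ) = N / k := fun j => by
    rw [hB.card_eq j, Nat.cast_div hkN hk0.ne']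
  have hcard0 : ∀ j, (B j).card ≠ 0 := fun j h => by
    have := hcard j
    rw [h, Nat.cast_zero] at this
    have : (0 : ℝ) < N / k := by positivity
    linarith
  -- If `r = 0`, then `l ≤ 0` and all variances vanish.
  have hQr : r = 0 → ∀ v, Q v = 0 := fun h v => by
    have hl0 : l ≤ 0 := by
      rw [h] at hrl
      by_contra! hpos
      have : 0 < l * L := by positivity
      norm_num at hrl
      linarith
    exact le_antisymm ((variance_inner_le_lambdaMax hν v).trans
      (mul_nonpos_of_nonpos_of_nonneg hl0 (sq_nonneg _))) (hQ0 v)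
  set s : ℝ := √(k / 10) with hs
  have hs0 : 0 < s := by positivity
  have hs2 : s ^ 2 = k / 10 := Real.sq_sqrt (by positivity)
  set c : ℝ := s * (r / 2) with hc
  have hc0 : 0 ≤ c := by positivity
  have hNc : N / k * c ^ 2 = N * r ^ 2 / 40 := by
    rw [hc, mul_pow, hs2]
    field_simp
    ring
  obtain ⟨A, hA, hPA, hbound⟩ := exists_event_card_le P
    (Y := fun j ω => blockMean B (fun i => X i ω) j - meanVec ν)
    (fun j => (measurable_blockMean hX j).sub_const _)
    ((iIndepFun_blockMean hX hindep hB).comp (fun _ z => z - meanVec ν) fun _ => by fun_prop)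
    (c := c) (q := fun v => Q v * (N / k * c ^ 2)⁻¹)
    ((continuous_variance_inner hν).measurable.mul_const _)
    (fun j v => by
      have hmem : MemLp (fun ω => inner ℝ (blockMean B (fun i => X i ω) j) v) 2 P := by
        simp_rw [inner_blockMean]
        exact (memLp_finsetSum _ fun i _ => memLp_inner_sample hν hlaw i v).const_mul _
      have hvar := variance_inner_blockMean hν hlaw hindep (B := B) j v
      have h := measureReal_lt_sub_integral_le hmem hc0 fun h => by
        rw [hvar, hcard]
        have hr0 : r = 0 := by
          rcases mul_eq_zero.1 h with h | h <;> linarith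
        change Q v / _ = 0
        rw [hQr hr0 v, zero_div]
      rw [integral_inner_blockMean hν hlaw j (hcard0 j), hvar, hcard] at h
      simp_rw [inner_sub_left]
      refine h.trans_eq ?_
      rw [div_div, div_eq_mul_inv]) hδ0
  refine ⟨A, hA, hPA, fun ω hω b hb => mem_defeatedSet_of_card_lt hr (fun u hu => ?_) hb⟩
  have hb := hbound ω hω (s • u) ((integrable_variance_inner_shift hν _).mul_const _)
  have hfilter : ∀ j, c < inner ℝ (blockMean B (fun i => X i ω) j - meanVec ν) (s • u) ↔
      r / 2 < inner ℝ (blockMean B (fun i => X i ω) j - meanVec ν) u := fun j => by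
    rw [inner_smul_right, hc, mul_lt_mul_iff_right₀ hs0]
  simp_rw [hfilter] at hb
  refine hb.trans_lt ?_
  rw [integral_mul_const, norm_smul, hu, mul_one, Real.norm_of_nonneg hs0.le, hs2]
  have hQu : Q (s • u) ≤ k / 10 * l := by
    have := variance_inner_le_lambdaMax hν (s • u)
    rw [norm_smul, hu, mul_one, Real.norm_of_nonneg hs0.le, hs2] at this
    change Q (s • u) ≤ l * (k / 10) at this
    linarith
  have hint : ∫ v, Q (v + s • u) ∂(stdGaussian (EuclideanSpace ℝ (Fin d))) ≤
      2 * T + 2 * Q (s • u) := integral_variance_inner_shift_le hν _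
  have hq : (∫ v, Q (v + s • u) ∂(stdGaussian (EuclideanSpace ℝ (Fin d)))) *
      (N / k * c ^ 2)⁻¹ ≤ 0.052 := by
    rcases hr.eq_or_lt with h0 | hpos
    · simp_rw [hQr h0.symm]
      norm_num
    · rw [hNc, mul_inv_le_iff₀ (by positivity)]
      have hkl : k * l ≤ 362 / 57600 * (N * r ^ 2) := by
        rcases le_total l 0 with h | h
        · have : k * l ≤ 0 := mul_nonpos_of_nonneg_of_nonpos hk0.le h
          have : 0 ≤ N * r ^ 2 := by positivity
          linarith
        · have := mul_le_mul_of_nonneg_right hkL' h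
          linarith
      linarith
  have he1 : 0 ≤ Real.exp 1 - 1 := by linarith [Real.add_one_le_exp 1]
  have he2 : Real.exp 1 - 1 ≤ 1.72 := by linarith [Real.exp_one_lt_d9]
  have hlast : 2 * (Real.exp 1 - 1) * k *
      ((∫ v, Q (v + s • u) ∂(stdGaussian (EuclideanSpace ℝ (Fin d)))) *
      (N / k * c ^ 2)⁻¹) ≤ 2 * 1.72 * k * 0.052 :=
    (mul_le_mul_of_nonneg_left hq (by positivity)).trans (by gcongr)
  linarith

end Deviation

theorem theorem1 {d N k : ℕ} {Ω : Type*} [MeasurableSpace Ω]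
    (P : Measure Ω) [IsProbabilityMeasure P]
    (δ : ℝ) (hδ0 : 0 < δ) (hδ1 : δ < 1)
    (hk : k = ⌈360 * Real.log (2 / δ)⌉₊) (hN : 0 < N) (hkN : k ∣ N)
    (B : Fin k → Finset (Fin N)) (hB : IsEqualPartition B)
    (ν : Measure (EuclideanSpace ℝ (Fin d))) (hν : MemLp id 2 ν)
    (X : Fin N → Ω → EuclideanSpace ℝ (Fin d))
    (hlaw : ∀ i, HasLaw (X i) ν P) (hindep : iIndepFun X P) :
    -- the estimator is well defined: a minimizer exists for every sample
    (∀ x : Fin N → EuclideanSpace ℝ (Fin d), ∃ a, IsTournamentMedian (blockMean B x) a) ∧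
    -- on an event of probability at least `1 - δ`, every minimizer satisfies the bound
    ∃ A : Set Ω, MeasurableSet A ∧ ENNReal.ofReal (1 - δ) ≤ P A ∧
      ∀ ω ∈ A, ∀ a, IsTournamentMedian (blockMean B fun i => X i ω) a →
        ‖a - meanVec ν‖ ≤
          2 * max (400 * √((covarianceMatrix ν).trace / N))
            (240 * √(lambdaMax (covarianceMatrix ν) * Real.log (2 / δ) / N)) := by
  have hL : 0 < Real.log (2 / δ) := Real.log_pos ((one_lt_div hδ0).2 (by linarith))
  have hk0 : 0 < k := hk ▸ Nat.ceil_pos.2 (by linarith)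
  refine ⟨fun x => exists_isTournamentMedian hk0 _, ?_⟩
  have hνP : IsProbabilityMeasure ν := (hlaw ⟨0, hN⟩).isProbabilityMeasure_iff.1 inferInstance
  set r := max (400 * √((covarianceMatrix ν).trace / N))
    (240 * √(lambdaMax (covarianceMatrix ν) * Real.log (2 / δ) / N)) with hr
  have hN0 : (0 : ℝ) < N := by exact_mod_cast hN
  have hr0 : 0 ≤ r := le_max_of_le_left (by positivity)
  have hsq : ∀ a y : ℝ, 0 ≤ a → a * √(y / N) ≤ r → a ^ 2 * y ≤ N * r ^ 2 := fun a y ha hy => by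
    rcases le_total y 0 with h | h
    · exact (mul_nonpos_of_nonneg_of_nonpos (sq_nonneg a) h).trans (by positivity)
    · have h2 := pow_le_pow_left₀ (by positivity) hy 2
      rw [mul_pow, Real.sq_sqrt (by positivity), ← mul_div_assoc, div_le_iff₀ hN0] at h2
      linarith
  have hrT := hsq 400 _ (by norm_num) (le_max_left _ _)
  have hrl := hsq 240 _ (by norm_num) (le_max_right _ _)
  norm_num at hrT hrl
  -- The `X i` are only almost everywhere measurable and are replaced by measurable versions.
  have hae : ∀ i, (hlaw i).aemeasurable.mk (X i) =ᵐ[P] X i := fun i =>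
    (hlaw i).aemeasurable.ae_eq_mk.symm
  obtain ⟨A, hA, hPA, hdef⟩ := exists_event_meanVec_defeats hδ0 hδ1 hk hN hkN hB hν
    (fun i => (hlaw i).aemeasurable.measurable_mk) (fun i => (hlaw i).congr (hae i))
    ((iIndepFun_congr hae).2 hindep) hr0 hrT hrl
  obtain ⟨S, hSsub, hSm, hS1⟩ : ∃ S ⊆ {ω | ∀ i, (hlaw i).aemeasurable.mk (X i) ω = X i ω},
      MeasurableSet S ∧ P Sᶜ = 0 := by
    obtain ⟨S, hS, hSm, hS0⟩ := exists_measurable_superset_of_null (ae_iff.1 (ae_all_iff.2 hae))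
    refine ⟨Sᶜ, fun ω hω => ?_, hSm.compl, by rwa [compl_compl]⟩
    by_contra h
    exact hω (hS h)
  refine ⟨A ∩ S, hA.inter hSm, ?_, fun ω hω a ha => ?_⟩
  · rwa [measure_inter_conull hS1]
  · have hX : (fun i => (hlaw i).aemeasurable.mk (X i) ω) = fun i => X i ω :=
      funext fun i => hSsub hω.2 i
    refine ha.norm_sub_le hk0 hr0 fun b hb => ?_
    rw [← hX]
    exact hdef ω hω.1 b hb
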